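/- Let $d\ge 1$. An \emph{ensemble} on $\mathbb C^d$ is a measurable map $x\mapsto\rho_x$ from a $\sigma$-finite measure space to positive semidefinite operators with $\operatorname{Tr}\rho_x\le 1$ and $\int\operatorname{Tr}[\rho_x]\,dx=1$; a \emph{POVM} is a measurable map $y\mapsto\pi_y$ from a $\sigma$-finite measure space to operators with $0\le\pi_y\le 1$ and $\int\pi_y\,dy=1$ (counting measure gives the discrete case). The \emph{informational power} $W(\pi_y)$ is the supremum over all ensembles $\rho_x$ of the mutual information (in nats) of the joint density $p_{x,y}=\operatorname{Tr}[\rho_x\pi_y]$. The POVM is a \emph{$2$-design} if the ensemble $\rho_y=\pi_y/d$ satisfies, for $k=1,2$, $$\int\frac{\rho_y^{\otimes k}}{(\operatorname{Tr}\rho_y)^{k-1}}\,dy=\int(|\psi\rangle\langle\psi|)^{\otimes k}\,d\psi ,$$ where $d\psi$ is the uniform probability measure on the unit sphere of $\mathbb C^d$. Put $W_2(d):=\ln\frac{2d}{d+1}$ and $\eta(x):=-x\ln x$. 1. Every $2$-design POVM on $\mathbb C^d$ satisfies $W(\pi_y)\le W_2(d)$. 2. This applies to SICs and to complete sets of MUBs: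 if $\varphi_1,\dots,\varphi_{d^2}\in\mathbb C^d$ are unit vectors with $|\langle\varphi_i|\varphi_j\rangle|^2=\frac1{d+1}$ for $i\ne j$, then $\big(\tfrac1d|\varphi_i\rangle\langle\varphi_i|\big)_i$ is a $2$-design POVM; and if $(b_{m,i})_{i=1}^d$, $m=0,\dots,d$, are orthonormal bases of $\mathbb C^d$ with $|\langle b_{m,i}|b_{n,j}\rangle|^2=\frac1d$ for $m\neq n$, then $\big(\tfrac1{d+1}|b_{m,i}\rangle\langle b_{m,i}|\big)_{m,i}$ is a $2$-design POVM. In particular both have informational power at most $W_2(d)$. 3. For $d\ge2$ and a node $x_1\in(0,1)$ let $p(x)=a_1x+a_2x^2$ satisfy $p(x_1)=\eta(x_1)$ and $p'(x_1)=\eta'(x_1)$. The minimum over $x_1\in(0,1)$ of the bounds $\ln d-d\sum_{k=1}^{2}a_k\binom{d+k-1}{k}^{-1}$ equals $W_2(d)$ and is attained at $x_1=\frac{2}{d+1}$. 4. $W_2(d)\to\ln 2$ nats, i.e. one bit, as $d\to\infty$. -/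

import Mathlib

open MeasureTheory Filter Topology
open scoped ENNReal ComplexOrder

namespace QuantumDesign

noncomputable section

/-- Operators on the `d`-dimensional Hilbert space, written in an orthonormal basis. -/
abbrev Op (d : ℕ) : Type := Matrix (Fin d) (Fin d) ℂ

/-- The trace of an operator, as a real number (used for products of positive operators). -/
def tr {d : ℕ} (A : Op d) : ℝ := A.trace.re

/-- The operator `|φ⟩⟨φ|`. -/
def ketbra {d : ℕ} (φ : EuclideanSpace ℂ (Fin d)) : Op d :=
  Matrix.vecMulVec (fun i => φ i) (fun j => star (φ j))

/-- A quantum state: positive semidefinite with trace at most one. -/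
def IsState {d : ℕ} (ρ : Op d) : Prop := ρ.PosSemidef ∧ tr ρ ≤ 1

/-- A quantum effect: `0 ≤ π ≤ 1`. -/
def IsEffect {d : ℕ} (π : Op d) : Prop := π.PosSemidef ∧ (1 - π).PosSemidef

/-- An ensemble: a measurable function `x ↦ ρ x` into the states with `∫ Tr[ρ x] dμ(x) = 1`.
Continuous labels (`X = ℝ` with Lebesgue measure) and discrete labels (counting measure)
are both instances. -/
structure IsEnsemble {d : ℕ} {X : Type*} [MeasurableSpace X] (μ : Measure X)
    (ρ : X → Op d) : Prop where
  measurable : ∀ i j, Measurable fun x => ρ x i j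
  state : ∀ x, IsState (ρ x)
  lintegral_tr : ∫⁻ x, ENNReal.ofReal (tr (ρ x)) ∂μ = 1

/-- A POVM: a measurable function `y ↦ π y` into the effects with `∫ π y dν(y) = 1`
(entry by entry). -/
structure IsPOVM {d : ℕ} {Y : Type*} [MeasurableSpace Y] (ν : Measure Y)
    (π : Y → Op d) : Prop where
  measurable : ∀ i j, Measurable fun y => π y i j
  effect : ∀ y, IsEffect (π y)
  integrable : ∀ i j, Integrable (fun y => π y i j) ν
  integral : ∀ i j, ∫ y, π y i j ∂ν = (1 : Op d) i j

/-- The uniform (Haar) probability measure on the unit sphere of `ℂ^d`. -/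
def uniformMeasure (d : ℕ) :
    Measure (Metric.sphere (0 : EuclideanSpace ℂ (Fin d)) 1) :=
  ((volume : Measure (EuclideanSpace ℂ (Fin d))).toSphere Set.univ)⁻¹ •
    (volume : Measure (EuclideanSpace ℂ (Fin d))).toSphere

/-- The uniform ensemble of pure states. -/
def uniformEnsemble (d : ℕ) :
    Metric.sphere (0 : EuclideanSpace ℂ (Fin d)) 1 → Op d :=
  fun ψ => ketbra (ψ : EuclideanSpace ℂ (Fin d))

/-- The `k`-fold tensor power, an operator on `(ℂ^d)^{⊗k}` in the product basis. -/
def tensorPow {d : ℕ} (k : ℕ) (A : Op d) : Matrix (Fin k → Fin d) (Fin k → Fin d) ℂ :=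
  Matrix.of fun i j => ∏ l, A (i l) (j l)

/-- `∫ ρ x ^{⊗k} / Tr[ρ x]^{k-1} dμ(x)`, entry by entry, for `k ≥ 1`. The integrand vanishes
where `ρ x = 0`, and each entry is bounded by `Tr[ρ x]`. -/
def moment {d : ℕ} {X : Type*} [MeasurableSpace X] (k : ℕ) (μ : Measure X)
    (ρ : X → Op d) : Matrix (Fin k → Fin d) (Fin k → Fin d) ℂ :=
  Matrix.of fun i j => ∫ x, tensorPow k (ρ x) i j / ((tr (ρ x) ^ (k - 1) : ℝ) : ℂ) ∂μ

/-- A spherical quantum `t`-design: an ensemble whose moments up to order `t` are those of the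
uniform ensemble. -/
def IsDesign {d : ℕ} {X : Type*} [MeasurableSpace X] (t : ℕ) (μ : Measure X)
    (ρ : X → Op d) : Prop :=
  IsEnsemble μ ρ ∧
    ∀ k, 1 ≤ k → k ≤ t → moment k μ ρ = moment k (uniformMeasure d) (uniformEnsemble d)

/-- A `t`-design POVM: a POVM that is a `t`-design after division by `d`, since a POVM on `ℂ^d`
has total trace `d`. -/
def IsDesignPOVM {d : ℕ} {Y : Type*} [MeasurableSpace Y] (t : ℕ) (ν : Measure Y)
    (π : Y → Op d) : Prop :=
  IsPOVM ν π ∧ IsDesign t ν fun y => (d : ℂ)⁻¹ • π y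

/-- The joint law of input and outcome, with density `Tr[ρ x π y]` (Born rule). -/
def jointLaw {d : ℕ} {X Y : Type*} [MeasurableSpace X] [MeasurableSpace Y]
    (μ : Measure X) (ν : Measure Y) (ρ : X → Op d) (π : Y → Op d) : Measure (X × Y) :=
  (μ.prod ν).withDensity fun z => ENNReal.ofReal (tr (ρ z.1 * π z.2))

/-- The mutual information (in nats): the relative entropy of the joint law with respect to the
product of its marginals. -/
def mutualInformation {d : ℕ} {X Y : Type*} [MeasurableSpace X] [MeasurableSpace Y]
    (μ : Measure X) (ν : Measure Y) (ρ : X → Op d) (π : Y → Op d) : ℝ≥0∞ :=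
  InformationTheory.klDiv (jointLaw μ ν ρ π)
    ((jointLaw μ ν ρ π).fst.prod (jointLaw μ ν ρ π).snd)

/-- The informational power of a POVM: the supremum of the mutual information over all
ensembles. -/
def informationalPower {d : ℕ} {Y : Type*} [MeasurableSpace Y] (ν : Measure Y)
    (π : Y → Op d) : ℝ≥0∞ :=
  ⨆ (X : Type) (_ : MeasurableSpace X) (μ : Measure X) (_ : SigmaFinite μ)
    (ρ : X → Op d) (_ : IsEnsemble μ ρ), mutualInformation μ ν ρ π

/-- `W₂(d) = ln (2d / (d+1))`. -/
def W₂ (d : ℕ) : ℝ := Real.log (2 * d / (d + 1))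

/-- `p = ∑_{k=1}^t a_k x^k` interpolates `η(x) = -x ln x` to first order at the nodes
`0 < x_1 < ⋯ < x_{⌊t/2⌋} < 1`, with `p(1) = 0` if `t` is odd. -/
structure IsInterpolant (t : ℕ) (x : Fin (t / 2) → ℝ) (p : Polynomial ℝ) : Prop where
  strictMono : StrictMono x
  mem_Ioo : ∀ i, x i ∈ Set.Ioo (0 : ℝ) 1
  natDegree_le : p.natDegree ≤ t
  coeff_zero : p.coeff 0 = 0
  eval_one : Odd t → p.eval 1 = 0
  eval_node : ∀ i, p.eval (x i) = Real.negMulLog (x i)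
  deriv_node : ∀ i, p.derivative.eval (x i) = deriv Real.negMulLog (x i)

/-- The bound `ln d - d ∑_{k=1}^t a_k / C(d+k-1, k)` given by the polynomial
`p = ∑ a_k x^k`. -/
def interpolationBound (d t : ℕ) (p : Polynomial ℝ) : ℝ :=
  Real.log d - d * ∑ k ∈ Finset.Icc 1 t, p.coeff k * ((Nat.choose (d + k - 1) k : ℕ) : ℝ)⁻¹

/-- A SIC: `d²` unit vectors in `ℂ^d` with pairwise squared overlaps `1/(d+1)`. -/
structure IsSIC {d : ℕ} (φ : Fin (d ^ 2) → EuclideanSpace ℂ (Fin d)) : Prop where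
  norm_eq_one : ∀ i, ‖φ i‖ = 1
  overlap : ∀ i j, i ≠ j → ‖inner ℂ (φ i) (φ j)‖ ^ 2 = 1 / ((d : ℝ) + 1)

/-- The POVM of a SIC, with elements `|φ_i⟩⟨φ_i| / d`. -/
def sicPOVM {d : ℕ} (φ : Fin (d ^ 2) → EuclideanSpace ℂ (Fin d)) : Fin (d ^ 2) → Op d :=
  fun i => (d : ℂ)⁻¹ • ketbra (φ i)

/-- A complete set of MUBs: `d+1` orthonormal bases of `ℂ^d`, vectors from different bases having
squared overlap `1/d`. -/
def IsCompleteMUB {d : ℕ}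
    (b : Fin (d + 1) → OrthonormalBasis (Fin d) ℂ (EuclideanSpace ℂ (Fin d))) : Prop :=
  ∀ m n, m ≠ n → ∀ i j, ‖inner ℂ (b m i) (b n j)‖ ^ 2 = 1 / (d : ℝ)

/-- The POVM of a complete set of MUBs, with elements `|b_{m,i}⟩⟨b_{m,i}| / (d+1)`. -/
def mubPOVM {d : ℕ}
    (b : Fin (d + 1) → OrthonormalBasis (Fin d) ℂ (EuclideanSpace ℂ (Fin d))) :
    Fin (d + 1) × Fin d → Op d :=
  fun z => ((d : ℂ) + 1)⁻¹ • ketbra (b z.1 z.2)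

end

end QuantumDesign

/-! Let `f` be the joint density, `a` and `q` its marginals, `r = Tr π / d` and `c = 2d/(d+1)`.
Split `log (f/(a q))` as `log c + log (f/(a r c)) + log (r/q)`. By `log u ≤ u - 1`, the last two
terms have nonpositive mean under `f` as soon as `∫ f²/r dy ≤ c a²` and `∫ r ≤ 1`, so the mutual
information is at most `log c` (`klDiv_prod_marginals_le`). The integral of `f²/r` depends only on
the second moment of the POVM. If that moment is the normalized symmetric projection, the integral
equals `d/(d+1) * ((Tr ρ)² + Tr ρ²)`, and `Tr ρ² ≤ (Tr ρ)²` gives `c` (`mutualInformation_le`).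

It remains to identify second moments. The mean of `|ψ⟩⟨ψ|^{⊗2}` minus the normalized projection has
squared norm equal to the frame potential minus `2/(d(d+1))`, so attaining this value forces the
moment (`integral_tensor_eq`). The uniform measure attains it by unitary invariance
(`uniform_frame`); SICs and MUBs attain it by counting overlaps (`isDesignPOVM_of_frame`).

For the interpolation bounds, a node `s` gives `W₂ d + (u - 1 - log u)` with `u = 2/((d+1)s)`, which
is least at `u = 1`. -/

namespace QuantumDesign

/-! ### Bounding mutual information by a second moment -/

section InformationBound

variable {X Y : Type*} [MeasurableSpace X] [MeasurableSpace Y]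
  {μ : Measure X} {ν : Measure Y} [SigmaFinite μ] [SigmaFinite ν]

lemma fst_withDensity_prod {f : X × Y → ℝ≥0∞} (hf : Measurable f) :
    ((μ.prod ν).withDensity f).fst = μ.withDensity fun x => ∫⁻ y, f (x, y) ∂ν := by
  ext s hs
  rw [Measure.fst_apply hs, withDensity_apply _ (measurable_fst hs), withDensity_apply _ hs]
  rw [← Set.prod_univ, ← Measure.prod_restrict, lintegral_prod _ hf.aemeasurable,
    Measure.restrict_univ]

lemma snd_withDensity_prod {f : X × Y → ℝ≥0∞} (hf : Measurable f) :
    ((μ.prod ν).withDensity f).snd = ν.withDensity fun y => ∫⁻ x, f (x, y) ∂μ := by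
  ext s hs
  rw [Measure.snd_apply hs, withDensity_apply _ (measurable_snd hs), withDensity_apply _ hs]
  rw [← Set.univ_prod, ← Measure.prod_restrict, lintegral_prod_symm _ hf.aemeasurable,
    Measure.restrict_univ]

/-- The relative entropy in terms of densities with respect to a common reference measure. -/
lemma klDiv_withDensity_mul {α : Type*} [MeasurableSpace α] {m : Measure α} [SigmaFinite m]
    {g h : α → ℝ} (hg : Measurable g) (hh : Measurable h) (hg0 : ∀ z, 0 ≤ g z)
    (hh0 : ∀ z, 0 ≤ h z) (hgh : ∀ᵐ z ∂m, h z = 0 → g z = 0)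
    [IsFiniteMeasure (m.withDensity fun z => ENNReal.ofReal (h z))]
    [IsFiniteMeasure (m.withDensity fun z => ENNReal.ofReal (g z))] :
    InformationTheory.klDiv (m.withDensity fun z => ENNReal.ofReal (g z))
        (m.withDensity fun z => ENNReal.ofReal (h z)) =
      ∫⁻ z, ENNReal.ofReal (h z * InformationTheory.klFun (g z / h z)) ∂m := by
  set ν := m.withDensity fun z => ENNReal.ofReal (h z) with hν
  have hgm : Measurable fun z => ENNReal.ofReal (g z / h z) := (hg.div hh).ennreal_ofReal
  -- Change of base measure: the density of one measure relative to the other is `g / h`; where `h`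
  -- vanishes so does `g`, almost everywhere.
  have heq : m.withDensity (fun z => ENNReal.ofReal (g z)) =
      ν.withDensity fun z => ENNReal.ofReal (g z / h z) := by
    rw [hν, ← withDensity_mul _ hh.ennreal_ofReal hgm]
    refine withDensity_congr_ae ?_
    filter_upwards [hgh] with z hz
    rw [Pi.mul_apply, ← ENNReal.ofReal_mul (hh0 z)]
    by_cases h0 : h z = 0
    · simp [h0, hz h0]
    · rw [mul_div_cancel₀ _ h0]
  rw [InformationTheory.klDiv_eq_lintegral_klFun_of_ac]
  · rw [heq, lintegral_congr_ae
      (g := fun z => ENNReal.ofReal (InformationTheory.klFun (g z / h z)))]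
    · rw [hν, lintegral_withDensity_eq_lintegral_mul _ hh.ennreal_ofReal (by fun_prop)]
      refine lintegral_congr fun z => ?_
      rw [Pi.mul_apply, ← ENNReal.ofReal_mul (hh0 z)]
    · filter_upwards [Measure.rnDeriv_withDensity ν hgm] with z hz
      rw [hz, ENNReal.toReal_ofReal (div_nonneg (hg0 z) (hh0 z))]
  · rw [heq]; exact withDensity_absolutelyContinuous _ _

/-- Pointwise form of the bound: concavity of the logarithm, used at `c` and at `1`. -/
lemma mul_klFun_add_le {f a q r c : ℝ} (hf : 0 ≤ f) (ha : 0 ≤ a) (hq : 0 ≤ q) (hr : 0 ≤ r)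
    (hc : 0 < c) (h0 : f ≠ 0 → a ≠ 0 ∧ q ≠ 0 ∧ r ≠ 0) :
    a * q * InformationTheory.klFun (f / (a * q)) + 3 * f ≤
      f * Real.log c + c⁻¹ * (a⁻¹ * (f ^ 2 / r)) + r / q * f + a * q := by
  rcases hf.eq_or_lt with rfl | hf
  · simp [InformationTheory.klFun]
  obtain ⟨ha', hq', hr'⟩ := h0 hf.ne'
  have ha := ha.lt_of_ne' ha'
  have hq := hq.lt_of_ne' hq'
  have hr := hr.lt_of_ne' hr'
  have h1 : Real.log (f / (a * q)) =
      Real.log c + Real.log (f / (a * r * c)) + Real.log (r / q) := by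
    rw [← Real.log_mul (by positivity) (by positivity),
      ← Real.log_mul (by positivity) (by positivity)]
    congr 1; field_simp
  have h2 := Real.log_le_sub_one_of_pos (show 0 < f / (a * r * c) by positivity)
  have h3 := Real.log_le_sub_one_of_pos (show 0 < r / q by positivity)
  have h4 : a * q * InformationTheory.klFun (f / (a * q)) =
      f * Real.log (f / (a * q)) + a * q - f := by
    rw [InformationTheory.klFun]; field_simp
  have h5 : c⁻¹ * (a⁻¹ * (f ^ 2 / r)) = f * (f / (a * r * c)) := by field_simp
  rw [h4, h5, h1]
  nlinarith [mul_le_mul_of_nonneg_left h2 hf.le, mul_le_mul_of_nonneg_left h3 hf.le]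

/-- If the joint density `f` has first marginal `a`, and its second moment with respect to the
probability density `r` is at most `c * a ^ 2`, then the mutual information is at most `log c`. -/
theorem klDiv_prod_marginals_le {f : X × Y → ℝ} {a : X → ℝ} {r : Y → ℝ} {c : ℝ}
    (hf : Measurable f) (ha : Measurable a) (hr : Measurable r)
    (hf0 : ∀ z, 0 ≤ f z) (ha0 : ∀ x, 0 ≤ a x) (hr0 : ∀ y, 0 ≤ r y) (hc : 1 ≤ c)
    (hfa : ∀ z, f z ≤ a z.1) (hfr : ∀ z, r z.2 = 0 → f z = 0)
    (hmarg : ∀ x, ∫⁻ y, ENNReal.ofReal (f (x, y)) ∂ν = ENNReal.ofReal (a x))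
    (haint : ∫⁻ x, ENNReal.ofReal (a x) ∂μ = 1)
    (hrint : ∫⁻ y, ENNReal.ofReal (r y) ∂ν ≤ 1)
    (hsq : ∀ x, ∫⁻ y, ENNReal.ofReal (f (x, y) ^ 2 / r y) ∂ν ≤ ENNReal.ofReal (c * a x ^ 2)) :
    InformationTheory.klDiv ((μ.prod ν).withDensity fun z => ENNReal.ofReal (f z))
      ((((μ.prod ν).withDensity fun z => ENNReal.ofReal (f z)).fst).prod
        (((μ.prod ν).withDensity fun z => ENNReal.ofReal (f z)).snd)) ≤
      ENNReal.ofReal (Real.log c) := by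
  have hfm := hf.ennreal_ofReal
  set Q : Y → ℝ≥0∞ := fun y => ∫⁻ x, ENNReal.ofReal (f (x, y)) ∂μ with hQ
  have hQm : Measurable Q := hfm.lintegral_prod_left'
  -- The bound `f ≤ a` makes the outcome marginal finite at every `y`, so its real version loses
  -- nothing.
  have hQ1 : ∀ y, Q y ≤ 1 := fun y => by
    rw [← haint]
    exact lintegral_mono fun x => ENNReal.ofReal_le_ofReal (hfa (x, y))
  have hQtop : ∀ y, Q y ≠ ∞ := fun y => ne_top_of_le_ne_top ENNReal.one_ne_top (hQ1 y)
  set q : Y → ℝ := fun y => (Q y).toReal with hq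
  have hqm : Measurable q := hQm.ennreal_toReal
  have hq0 : ∀ y, 0 ≤ q y := fun y => ENNReal.toReal_nonneg
  have hqQ : ∀ y, ENNReal.ofReal (q y) = Q y := fun y => ENNReal.ofReal_toReal (hQtop y)
  have hftot : ∫⁻ z, ENNReal.ofReal (f z) ∂(μ.prod ν) = 1 := by
    rw [lintegral_prod _ hfm.aemeasurable, ← haint]
    exact lintegral_congr hmarg
  have hQint : ∫⁻ y, Q y ∂ν = 1 := by
    rw [← hftot, lintegral_prod_symm _ hfm.aemeasurable]
  have hprod : (((μ.prod ν).withDensity fun z => ENNReal.ofReal (f z)).fst).prod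
        (((μ.prod ν).withDensity fun z => ENNReal.ofReal (f z)).snd) =
      (μ.prod ν).withDensity fun z => ENNReal.ofReal (a z.1 * q z.2) := by
    rw [fst_withDensity_prod hfm, snd_withDensity_prod hfm]
    simp only [hmarg]
    rw [prod_withDensity ha.ennreal_ofReal hQm]
    congr 1
    ext z
    rw [ENNReal.ofReal_mul (ha0 _), hqQ]
  have hatot : ∫⁻ z, ENNReal.ofReal (a z.1 * q z.2) ∂(μ.prod ν) = 1 := by
    simp_rw [ENNReal.ofReal_mul (ha0 _), hqQ]
    rw [lintegral_prod_mul ha.ennreal_ofReal.aemeasurable hQm.aemeasurable, haint, hQint, one_mul]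
  -- Absolute continuity: integrating `f` over `{q = 0}`, with `x` first, gives `0`.
  have hzero : ∀ᵐ z ∂(μ.prod ν), q z.2 = 0 → f z = 0 := by
    have hm : Measurable fun z : X × Y =>
        (Q ⁻¹' {0}).indicator 1 z.2 * ENNReal.ofReal (f z) :=
      ((measurable_one.indicator (hQm (measurableSet_singleton 0))).comp measurable_snd).mul hfm
    have h0 : ∫⁻ z, (Q ⁻¹' {0}).indicator 1 z.2 * ENNReal.ofReal (f z) ∂(μ.prod ν) = 0 := by
      rw [lintegral_prod_symm _ hm.aemeasurable]
      rw [lintegral_eq_zero_iff hm.lintegral_prod_left']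
      refine .of_forall fun y => ?_
      change ∫⁻ x, (Q ⁻¹' {0}).indicator 1 y * ENNReal.ofReal (f (x, y)) ∂μ = 0
      rw [lintegral_const_mul (f := fun x => ENNReal.ofReal (f (x, y))) _ (by fun_prop)]
      by_cases hy : Q y = 0
      · change _ * Q y = 0
        rw [hy, mul_zero]
      · simp [hy]
    filter_upwards [(lintegral_eq_zero_iff hm).1 h0] with z hz hqz
    have : Q z.2 = 0 := by rw [← hqQ, hqz, ENNReal.ofReal_zero]
    simp only [Pi.zero_apply, mul_eq_zero, ENNReal.ofReal_eq_zero] at hz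
    rcases hz with hz | hz
    · simp [this] at hz
    · exact le_antisymm hz (hf0 z)
  have haz : ∀ z : X × Y, a z.1 = 0 → f z = 0 := fun z h =>
    le_antisymm ((hfa z).trans h.le) (hf0 z)
  have hc0 : 0 < c := by linarith
  rw [hprod]
  have : IsFiniteMeasure ((μ.prod ν).withDensity fun z => ENNReal.ofReal (f z)) :=
    isFiniteMeasure_withDensity (by simp [hftot])
  have : IsFiniteMeasure ((μ.prod ν).withDensity fun z => ENNReal.ofReal (a z.1 * q z.2)) :=
    isFiniteMeasure_withDensity (by simp [hatot])
  rw [klDiv_withDensity_mul hf (by fun_prop) hf0 (fun z => mul_nonneg (ha0 _) (hq0 _))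
    (by filter_upwards [hzero] with z hz h
        exact (mul_eq_zero.1 h).elim (haz z) hz)]
  have hA : ∫⁻ z, ENNReal.ofReal (c⁻¹ * ((a z.1)⁻¹ * (f z ^ 2 / r z.2))) ∂(μ.prod ν) ≤ 1 := by
    rw [lintegral_prod _ (by fun_prop), ← haint]
    refine lintegral_mono fun x => ?_
    have h1 : ∀ y, ENNReal.ofReal (c⁻¹ * ((a x)⁻¹ * (f (x, y) ^ 2 / r y))) =
        ENNReal.ofReal (c⁻¹ * (a x)⁻¹) * ENNReal.ofReal (f (x, y) ^ 2 / r y) := fun y => by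
      rw [← ENNReal.ofReal_mul (mul_nonneg (by positivity) (inv_nonneg.2 (ha0 x))), mul_assoc]
    dsimp only
    simp_rw [h1]
    rw [lintegral_const_mul _ (by fun_prop)]
    refine (mul_le_mul_right (hsq x) _).trans ?_
    rw [← ENNReal.ofReal_mul (mul_nonneg (by positivity) (inv_nonneg.2 (ha0 x)))]
    refine ENNReal.ofReal_le_ofReal (le_of_eq ?_)
    by_cases h : a x = 0
    · simp [h]
    · field_simp
  have hB : ∫⁻ z, ENNReal.ofReal (r z.2 / q z.2 * f z) ∂(μ.prod ν) ≤ 1 := by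
    rw [lintegral_prod_symm _ (by fun_prop)]
    refine (lintegral_mono fun y => ?_).trans hrint
    have h1 : ∀ x, ENNReal.ofReal (r y / q y * f (x, y)) =
        ENNReal.ofReal (r y / q y) * ENNReal.ofReal (f (x, y)) := fun x =>
      ENNReal.ofReal_mul (div_nonneg (hr0 y) (hq0 y))
    dsimp only
    simp_rw [h1]
    rw [lintegral_const_mul _ (by fun_prop)]
    change _ * Q y ≤ _
    rw [← hqQ y, ← ENNReal.ofReal_mul (div_nonneg (hr0 y) (hq0 y))]
    refine ENNReal.ofReal_le_ofReal ?_
    -- Where `q y = 0` the quotient is `0` by convention, hence an inequality rather than an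
    -- equality.
    by_cases h : q y = 0
    · simpa [h] using hr0 y
    · rw [div_mul_cancel₀ _ h]
  have hlog := Real.log_nonneg hc
  -- Adding `3 f`, of integral `3`, keeps every term nonnegative, so no integrability is needed. The
  -- three last terms on the right integrate to at most `1` each, and the `3` cancels.
  have key : ∫⁻ z, ENNReal.ofReal (a z.1 * q z.2 *
        InformationTheory.klFun (f z / (a z.1 * q z.2))) ∂(μ.prod ν) + 3 ≤
      ENNReal.ofReal (Real.log c) + 3 := by
    calc
      _ = ∫⁻ z, (ENNReal.ofReal (a z.1 * q z.2 *
            InformationTheory.klFun (f z / (a z.1 * q z.2))) +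
            3 * ENNReal.ofReal (f z)) ∂(μ.prod ν) := by
          rw [lintegral_add_right _ (by fun_prop), lintegral_const_mul _ hfm, hftot, mul_one]
      _ ≤ ∫⁻ z, (ENNReal.ofReal (f z) * ENNReal.ofReal (Real.log c) +
            ENNReal.ofReal (c⁻¹ * ((a z.1)⁻¹ * (f z ^ 2 / r z.2))) +
            ENNReal.ofReal (r z.2 / q z.2 * f z) +
            ENNReal.ofReal (a z.1 * q z.2)) ∂(μ.prod ν) := by
          refine lintegral_mono_ae ?_
          filter_upwards [hzero] with z hz
          have hf' := hf0 z
          have ha' := ha0 z.1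
          have hq' := hq0 z.2
          have hr' := hr0 z.2
          have h3 : (3 : ℝ≥0∞) = ENNReal.ofReal 3 := by norm_num
          rw [h3, ← ENNReal.ofReal_mul (by norm_num), ← ENNReal.ofReal_mul hf',
            ← ENNReal.ofReal_add
              (mul_nonneg (by positivity) (InformationTheory.klFun_nonneg (by positivity)))
              (by positivity),
            ← ENNReal.ofReal_add (by positivity) (by positivity),
            ← ENNReal.ofReal_add (by positivity) (by positivity),
            ← ENNReal.ofReal_add (by positivity) (by positivity)]
          exact ENNReal.ofReal_le_ofReal (mul_klFun_add_le hf' ha' hq' hr' hc0 fun h =>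
            ⟨fun h' => h (haz z h'), fun h' => h (hz h'), fun h' => h (hfr z h')⟩)
      _ ≤ ENNReal.ofReal (Real.log c) + 1 + 1 + 1 := by
          rw [lintegral_add_right _ (by fun_prop), lintegral_add_right _ (by fun_prop),
            lintegral_add_right _ (by fun_prop), lintegral_mul_const _ hfm, hftot, hatot, one_mul]
          gcongr
      _ = _ := by rw [add_assoc, add_assoc]; norm_num
  exact (ENNReal.add_le_add_iff_right (by norm_num)).1 key

end InformationBound

/-! ### Trace inequalities for positive operators -/

section Positive

variable {d : ℕ} {A B : Op d}

open scoped MatrixOrder in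
lemma trace_mul_nonneg (hA : A.PosSemidef) (hB : B.PosSemidef) : 0 ≤ (A * B).trace := by
  obtain ⟨C, rfl⟩ := CStarAlgebra.nonneg_iff_eq_star_mul_self.mp hA.nonneg
  rw [Matrix.mul_assoc, Matrix.trace_mul_comm]
  exact (hB.mul_mul_conjTranspose_same C).trace_nonneg

lemma tr_mul_nonneg (hA : A.PosSemidef) (hB : B.PosSemidef) : 0 ≤ tr (A * B) :=
  (Complex.le_def.1 (trace_mul_nonneg hA hB)).1

lemma tr_nonneg (hA : A.PosSemidef) : 0 ≤ tr A := (Complex.le_def.1 hA.trace_nonneg).1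

lemma ofReal_tr (hA : A.PosSemidef) : (tr A : ℂ) = A.trace :=
  (Complex.eq_re_of_ofReal_le hA.trace_nonneg).symm

lemma ofReal_tr_mul (hA : A.PosSemidef) (hB : B.PosSemidef) :
    (tr (A * B) : ℂ) = (A * B).trace :=
  (Complex.eq_re_of_ofReal_le (trace_mul_nonneg hA hB)).symm

lemma tr_eq_zero_iff (hA : A.PosSemidef) : tr A = 0 ↔ A = 0 := by
  rw [← hA.trace_eq_zero_iff, ← ofReal_tr hA, Complex.ofReal_eq_zero]

/-- Nonnegativity of the 2×2 minor on the indices `i`, `j`; the case `i = j` is covered, since the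
submatrix may repeat an index. -/
lemma norm_entry_sq_le (hA : A.PosSemidef) (i j : Fin d) :
    ‖A i j‖ ^ 2 ≤ (A i i).re * (A j j).re := by
  have h := (hA.submatrix ![i, j]).det_nonneg
  rw [Matrix.det_fin_two] at h
  simp only [Matrix.submatrix_apply, Matrix.cons_val_zero, Matrix.cons_val_one] at h
  have hji : A j i = star (A i j) := (hA.1.apply j i).symm
  have hi : ((A i i).re : ℂ) = A i i := (Complex.eq_re_of_ofReal_le hA.diag_nonneg).symm
  have hj : ((A j j).re : ℂ) = A j j := (Complex.eq_re_of_ofReal_le hA.diag_nonneg).symm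
  rw [hji, ← hi, ← hj, ← starRingEnd_apply, Complex.mul_conj'] at h
  norm_cast at h
  simpa using h

lemma diag_re_nonneg (hA : A.PosSemidef) (i : Fin d) : 0 ≤ (A i i).re :=
  (Complex.le_def.1 hA.diag_nonneg).1

lemma tr_eq_sum (A : Op d) : tr A = ∑ i, (A i i).re := by
  simp [tr, Matrix.trace]

lemma norm_entry_le_tr (hA : A.PosSemidef) (i j : Fin d) : ‖A i j‖ ≤ tr A := by
  have hle : ∀ k, (A k k).re ≤ tr A := fun k => by
    rw [tr_eq_sum]
    exact Finset.single_le_sum (f := fun k => (A k k).re) (fun k _ => diag_re_nonneg hA k)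
      (Finset.mem_univ k)
  refine le_of_sq_le_sq ?_ (tr_nonneg hA)
  refine (norm_entry_sq_le hA i j).trans ?_
  rw [sq]
  exact mul_le_mul (hle i) (hle j) (diag_re_nonneg hA j) (tr_nonneg hA)

lemma tr_mul_self_le (hA : A.PosSemidef) : tr (A * A) ≤ tr A ^ 2 := by
  rw [tr_eq_sum, sq, tr_eq_sum, Finset.sum_mul_sum]
  refine Finset.sum_le_sum fun i _ => ?_
  rw [Matrix.mul_apply, Complex.re_sum]
  refine Finset.sum_le_sum fun j _ => ?_
  rw [← hA.1.apply j i, ← starRingEnd_apply, Complex.mul_conj', ← Complex.ofReal_pow,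
    Complex.ofReal_re]
  exact norm_entry_sq_le hA i j

lemma trace_mul_eq_sum (A B : Op d) : (A * B).trace = ∑ i, ∑ j, A i j * B j i := by
  simp [Matrix.trace, Matrix.mul_apply]

end Positive

/-- The second moment of the uniform distribution of pure states: the projection onto the
symmetric subspace, divided by its rank. -/
noncomputable def symTensor (d : ℕ) (i j k l : Fin d) : ℂ :=
  ((1 : Op d) i k * (1 : Op d) j l + (1 : Op d) i l * (1 : Op d) j k) / (d * (d + 1))

lemma measurable_tr {d : ℕ} {X : Type*} [MeasurableSpace X] {ρ : X → Op d}
    (h : ∀ i j, Measurable fun x => ρ x i j) : Measurable fun x => tr (ρ x) := by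
  simp_rw [tr_eq_sum]
  exact Finset.measurable_fun_sum _ fun i _ => Complex.measurable_re.comp (h i i)

/-! ### Moments of ensembles and the bound on informational power -/

section Ensemble

variable {d : ℕ} {X Y : Type*} [MeasurableSpace X] [MeasurableSpace Y]
  {μ : Measure X} {ν : Measure Y} {ρ : X → Op d} {π : Y → Op d}

lemma IsEnsemble.integrable_tr (h : IsEnsemble μ ρ) : Integrable (fun x => tr (ρ x)) μ := by
  refine ⟨(measurable_tr h.measurable).aestronglyMeasurable, ?_⟩
  rw [hasFiniteIntegral_iff_ofReal (.of_forall fun x => tr_nonneg (h.state x).1), h.lintegral_tr]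
  exact ENNReal.one_lt_top

lemma moment_two_apply (i j k l : Fin d) :
    moment 2 μ ρ ![i, j] ![k, l] = ∫ x, ρ x i k * ρ x j l / (tr (ρ x) : ℂ) ∂μ := by
  simp [moment, tensorPow, Fin.prod_univ_two]

lemma moment_one_apply (i k : Fin d) : moment 1 μ ρ ![i] ![k] = ∫ x, ρ x i k ∂μ := by
  simp [moment, tensorPow]

lemma IsEnsemble.integrable_second (h : IsEnsemble μ ρ) (i j k l : Fin d) :
    Integrable (fun x => ρ x i k * ρ x j l / (tr (ρ x) : ℂ)) μ := by
  refine h.integrable_tr.mono' ?_ (.of_forall fun x => ?_)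
  · exact (((h.measurable i k).mul (h.measurable j l)).div
      (Complex.measurable_ofReal.comp (measurable_tr h.measurable))).aestronglyMeasurable
  · have h0 := tr_nonneg (h.state x).1
    rw [norm_div, norm_mul, Complex.norm_real, Real.norm_of_nonneg h0]
    refine div_le_of_le_mul₀ h0 h0 ?_
    exact mul_le_mul (norm_entry_le_tr (h.state x).1 i k) (norm_entry_le_tr (h.state x).1 j l)
      (norm_nonneg _) h0

/-- Contracted with `A ⊗ A`, the identity part gives `(Tr A)²` and the swap part gives `Tr A²`. -/
lemma sum_symTensor (A : Op d) :
    ∑ i, ∑ j, ∑ k, ∑ l, A k i * A l j * symTensor d i j k l =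
      (A.trace ^ 2 + (A * A).trace) / (d * (d + 1)) := by
  simp_rw [symTensor, mul_div_assoc', mul_add, ← Finset.sum_div, Finset.sum_add_distrib,
    Matrix.one_apply]
  simp [Matrix.trace, Matrix.mul_apply, sq, Finset.sum_mul_sum]
  congr 2
  exact Finset.sum_congr rfl fun i _ => Finset.sum_congr rfl fun j _ => mul_comm _ _

/-- `Tr[A π]²` is linear in `π ⊗ π`, so only the second moment of the ensemble enters. -/
lemma IsEnsemble.integral_tr_mul_sq (h : IsEnsemble ν π)
    (hmom : ∀ i j k l, moment 2 ν π ![i, j] ![k, l] = symTensor d i j k l) {A : Op d}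
    (hA : A.PosSemidef) :
    Integrable (fun y => tr (A * π y) ^ 2 / tr (π y)) ν ∧
    ∫ y, tr (A * π y) ^ 2 / tr (π y) ∂ν = (tr A ^ 2 + tr (A * A)) / (d * (d + 1)) := by
  have hpt : ∀ y, ((tr (A * π y) ^ 2 / tr (π y) : ℝ) : ℂ) =
      ∑ i, ∑ j, ∑ k, ∑ l, A k i * A l j * (π y i k * π y j l / (tr (π y) : ℂ)) := fun y => by
    rw [Complex.ofReal_div, Complex.ofReal_pow, ofReal_tr_mul hA (h.state y).1,
      Matrix.trace_mul_comm, trace_mul_eq_sum, sq, Finset.sum_mul_sum, Finset.sum_div]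
    refine Finset.sum_congr rfl fun i _ => ?_
    rw [Finset.sum_div]
    refine Finset.sum_congr rfl fun j _ => ?_
    rw [Finset.sum_mul_sum, Finset.sum_div]
    refine Finset.sum_congr rfl fun k _ => ?_
    rw [Finset.sum_div]
    refine Finset.sum_congr rfl fun l _ => ?_
    ring
  have hint : ∀ i j k l, Integrable
      (fun y => A k i * A l j * (π y i k * π y j l / (tr (π y) : ℂ))) ν :=
    fun i j k l => (h.integrable_second i j k l).const_mul _
  have hC : Integrable (fun y => ((tr (A * π y) ^ 2 / tr (π y) : ℝ) : ℂ)) ν := by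
    simp_rw [hpt]
    exact integrable_finsetSum _ fun i _ => integrable_finsetSum _ fun j _ =>
      integrable_finsetSum _ fun k _ => integrable_finsetSum _ fun l _ => hint i j k l
  refine ⟨hC.re, ?_⟩
  apply Complex.ofReal_injective
  rw [← integral_complex_ofReal]
  simp_rw [hpt]
  rw [integral_finsetSum _ fun i _ => integrable_finsetSum _ fun j _ =>
      integrable_finsetSum _ fun k _ => integrable_finsetSum _ fun l _ => hint i j k l]
  push_cast
  rw [ofReal_tr hA, ofReal_tr_mul hA hA, ← sum_symTensor]
  refine Finset.sum_congr rfl fun i _ => ?_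
  rw [integral_finsetSum _ fun j _ =>
      integrable_finsetSum _ fun k _ => integrable_finsetSum _ fun l _ => hint i j k l]
  refine Finset.sum_congr rfl fun j _ => ?_
  rw [integral_finsetSum _ fun k _ => integrable_finsetSum _ fun l _ => hint i j k l]
  refine Finset.sum_congr rfl fun k _ => ?_
  rw [integral_finsetSum _ fun l _ => hint i j k l]
  refine Finset.sum_congr rfl fun l _ => ?_
  rw [integral_const_mul, ← moment_two_apply, hmom]

lemma IsPOVM.lintegral_tr_mul (h : IsPOVM ν π) {A : Op d} (hA : A.PosSemidef) :
    ∫⁻ y, ENNReal.ofReal (tr (A * π y)) ∂ν = ENNReal.ofReal (tr A) := by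
  have hterm : ∀ i j, Integrable (fun y => A i j * π y j i) ν := fun i j =>
    (h.integrable j i).const_mul _
  have hint : Integrable (fun y => (A * π y).trace) ν := by
    simp_rw [trace_mul_eq_sum]
    exact integrable_finsetSum _ fun i _ => integrable_finsetSum _ fun j _ => hterm i j
  have hre : Integrable (fun y => tr (A * π y)) ν := hint.re
  rw [← ofReal_integral_eq_lintegral_ofReal hre
    (.of_forall fun y => tr_mul_nonneg hA (h.effect y).1)]
  congr 1
  have h1 : ∫ y, (A * π y).trace ∂ν = A.trace := by
    simp_rw [trace_mul_eq_sum]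
    rw [integral_finsetSum _ fun i _ => integrable_finsetSum _ fun j _ => hterm i j]
    refine (Finset.sum_congr rfl fun i _ => ?_).trans (?_ : ∑ i, A i i = _)
    · rw [integral_finsetSum _ fun j _ => hterm i j]
      simp_rw [integral_const_mul, h.integral, Matrix.one_apply]
      simp
    · rfl
  rw [tr, ← h1]
  exact integral_re hint

/-- Every POVM whose second moment is that of the uniform ensemble has mutual information at
most `W₂ d` with every ensemble. -/
theorem mutualInformation_le [SigmaFinite μ] [SigmaFinite ν] (hd : 1 ≤ d)
    (hρ : IsEnsemble μ ρ) (hpovm : IsPOVM ν π)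
    (hens : IsEnsemble ν fun y => (d : ℂ)⁻¹ • π y)
    (hmom : ∀ i j k l, moment 2 ν (fun y => (d : ℂ)⁻¹ • π y) ![i, j] ![k, l] =
      symTensor d i j k l) :
    mutualInformation μ ν ρ π ≤ ENNReal.ofReal (W₂ d) := by
  have hd1 : (1 : ℝ) ≤ d := by exact_mod_cast hd
  have hscale : ∀ A B : Op d, tr (A * B) = d * tr (A * ((d : ℂ)⁻¹ • B)) := fun A B => by
    simp only [tr, Matrix.mul_smul, Matrix.trace_smul, smul_eq_mul]
    rw [← Complex.ofReal_natCast, ← Complex.ofReal_inv, Complex.re_ofReal_mul]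
    field_simp
  have hf : Measurable fun z : X × Y => tr (ρ z.1 * π z.2) := by
    refine measurable_tr fun i j => ?_
    simp_rw [Matrix.mul_apply]
    exact Finset.measurable_fun_sum _ fun k _ =>
      ((hρ.measurable i k).comp measurable_fst).mul ((hpovm.measurable k j).comp measurable_snd)
  -- This is `Tr[ρ (1 - π)] ≥ 0`.
  have hfa : ∀ z : X × Y, tr (ρ z.1 * π z.2) ≤ tr (ρ z.1) := fun z => by
    have := tr_mul_nonneg (hρ.state z.1).1 (hpovm.effect z.2).2
    rw [mul_sub, mul_one, tr, Matrix.trace_sub, Complex.sub_re] at this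
    simp only [tr]
    linarith
  have hfr : ∀ z : X × Y, tr ((d : ℂ)⁻¹ • π z.2) = 0 → tr (ρ z.1 * π z.2) = 0 := fun z hz => by
    rw [hscale, (tr_eq_zero_iff (hens.state z.2).1).1 hz]
    simp [tr]
  have hsq : ∀ x, ∫⁻ y, ENNReal.ofReal (tr (ρ x * π y) ^ 2 / tr ((d : ℂ)⁻¹ • π y)) ∂ν ≤
      ENNReal.ofReal (2 * d / (d + 1) * tr (ρ x) ^ 2) := fun x => by
    obtain ⟨hi, he⟩ := hens.integral_tr_mul_sq hmom (hρ.state x).1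
    have hpt : ∀ y, tr (ρ x * π y) ^ 2 / tr ((d : ℂ)⁻¹ • π y) =
        d ^ 2 * (tr (ρ x * ((d : ℂ)⁻¹ • π y)) ^ 2 / tr ((d : ℂ)⁻¹ • π y)) := fun y => by
      rw [hscale]; ring
    have h0 : ∀ y, 0 ≤ d ^ 2 * (tr (ρ x * ((d : ℂ)⁻¹ • π y)) ^ 2 / tr ((d : ℂ)⁻¹ • π y)) :=
      fun y => mul_nonneg (sq_nonneg _) (div_nonneg (sq_nonneg _) (tr_nonneg (hens.state y).1))
    simp_rw [hpt]
    rw [← ofReal_integral_eq_lintegral_ofReal (hi.const_mul _) (.of_forall h0),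
      integral_const_mul, he]
    refine ENNReal.ofReal_le_ofReal ?_
    have h1 := tr_mul_self_le (hρ.state x).1
    calc (d : ℝ) ^ 2 * ((tr (ρ x) ^ 2 + tr (ρ x * ρ x)) / (d * (d + 1)))
        = d / (d + 1) * (tr (ρ x) ^ 2 + tr (ρ x * ρ x)) := by field_simp
      _ ≤ d / (d + 1) * (tr (ρ x) ^ 2 + tr (ρ x) ^ 2) := by gcongr
      _ = 2 * d / (d + 1) * tr (ρ x) ^ 2 := by ring
  have hc : (1 : ℝ) ≤ 2 * d / (d + 1) := by
    rw [le_div_iff₀ (by positivity)]; linarith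
  have h0 : ∀ z : X × Y, 0 ≤ tr (ρ z.1 * π z.2) := fun z =>
    tr_mul_nonneg (hρ.state _).1 (hpovm.effect _).1
  have hmarg : ∀ x, ∫⁻ y, ENNReal.ofReal (tr (ρ x * π y)) ∂ν = ENNReal.ofReal (tr (ρ x)) :=
    fun x => hpovm.lintegral_tr_mul (A := ρ x) (hρ.state x).1
  exact klDiv_prod_marginals_le (f := fun z : X × Y => tr (ρ z.1 * π z.2))
    (a := fun x => tr (ρ x)) (r := fun y => tr ((d : ℂ)⁻¹ • π y)) hf (measurable_tr hρ.measurable)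
    (measurable_tr hens.measurable)
    h0 (fun x => tr_nonneg (hρ.state x).1)
    (fun y => tr_nonneg (hens.state y).1) hc hfa hfr
    hmarg hρ.lintegral_tr hens.lintegral_tr.le hsq

theorem informationalPower_le [SigmaFinite ν] (hd : 1 ≤ d) (hpovm : IsPOVM ν π)
    (hens : IsEnsemble ν fun y => (d : ℂ)⁻¹ • π y)
    (hmom : ∀ i j k l, moment 2 ν (fun y => (d : ℂ)⁻¹ • π y) ![i, j] ![k, l] =
      symTensor d i j k l) :
    informationalPower ν π ≤ ENNReal.ofReal (W₂ d) := by
  simp only [informationalPower, iSup_le_iff]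
  intro X _ μ _ ρ hρ
  exact mutualInformation_le hd hρ hpovm hens hmom

end Ensemble

/-! ### Frame potential and the symmetric projection -/

section Frame

/-- If the mean overlap of `v` with itself and its overlap with `S` agree with `⟪S, S⟫`, then the
mean of `v` is `S`. -/
lemma integral_eq_of_inner_eq {Ω H : Type*} [MeasurableSpace Ω] {P : Measure Ω}
    [IsProbabilityMeasure P] [NormedAddCommGroup H] [InnerProductSpace ℂ H] [CompleteSpace H]
    {v : Ω → H} (hv : Integrable v P) {S : H} {s : ℂ}
    (hvv : ∫ ω, ∫ ω', inner ℂ (v ω) (v ω') ∂P ∂P = s) (hSv : ∀ ω, inner ℂ S (v ω) = s)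
    (hSS : inner ℂ S S = s) : ∫ ω, v ω ∂P = S := by
  have h1 : inner ℂ S (∫ ω, v ω ∂P) = s := by
    rw [← integral_inner hv]; simp [hSv]
  have hs : (starRingEnd ℂ) s = s := by rw [← hSS, inner_conj_symm]
  have h2 : inner ℂ (∫ ω, v ω ∂P) S = s := by rw [← inner_conj_symm, h1, hs]
  have h3 : inner ℂ (∫ ω, v ω ∂P) (∫ ω, v ω ∂P) = s := by
    rw [← hs, ← hvv, ← integral_inner hv, ← integral_conj]
    refine integral_congr_ae (.of_forall fun ω => ?_)
    simp only
    rw [integral_inner hv, inner_conj_symm]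
  -- The squared norm of mean minus `S` expands to `s - s - s + s`.
  rw [← sub_eq_zero, ← inner_self_eq_zero (𝕜 := ℂ), inner_sub_left, inner_sub_right,
    inner_sub_right, h1, h2, h3, hSS]
  ring

variable {d : ℕ}

/-- The entries of `|ψ⟩⟨ψ|^{⊗2}`, as a vector. -/
noncomputable def tensorVec (ψ : EuclideanSpace ℂ (Fin d)) :
    EuclideanSpace ℂ (Fin d × Fin d × Fin d × Fin d) :=
  WithLp.toLp 2 fun z => ψ z.1 * ψ z.2.1 * star (ψ z.2.2.1) * star (ψ z.2.2.2)

/-- The entries of `symTensor`, as a vector. -/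
noncomputable def symVec (d : ℕ) : EuclideanSpace ℂ (Fin d × Fin d × Fin d × Fin d) :=
  WithLp.toLp 2 fun z => symTensor d z.1 z.2.1 z.2.2.1 z.2.2.2

lemma sum_mul_star_self (ψ : EuclideanSpace ℂ (Fin d)) :
    ∑ i, ψ i * star (ψ i) = (‖ψ‖ : ℂ) ^ 2 := by
  rw [← Complex.ofReal_pow, EuclideanSpace.norm_sq_eq, Complex.ofReal_sum]
  refine Finset.sum_congr rfl fun i _ => ?_
  rw [← starRingEnd_apply, Complex.mul_conj', Complex.ofReal_pow]

lemma sum_mul_mul_mul {ι R : Type*} [Fintype ι] [CommSemiring R] (a b : ι → R) :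
    ∑ i, ∑ j, ∑ k, ∑ l, a i * a j * (b k * b l) =
      ((∑ i, a i) * ∑ i, a i) * ((∑ i, b i) * ∑ i, b i) := by
  simp only [← Finset.mul_sum, ← Finset.sum_mul]

lemma inner_tensorVec (φ ψ : EuclideanSpace ℂ (Fin d)) :
    inner ℂ (tensorVec φ) (tensorVec ψ) = ((‖inner ℂ φ ψ‖ ^ 4 : ℝ) : ℂ) := by
  have h1 : inner ℂ φ ψ = ∑ i, ψ i * star (φ i) := by
    simp [PiLp.inner_apply]
  have h2 : (starRingEnd ℂ) (inner ℂ φ ψ) = ∑ i, φ i * star (ψ i) := by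
    rw [h1, map_sum]; simp [mul_comm]
  have h3 : ((‖inner ℂ φ ψ‖ ^ 4 : ℝ) : ℂ) =
      (inner ℂ φ ψ * inner ℂ φ ψ) *
        ((starRingEnd ℂ) (inner ℂ φ ψ) * (starRingEnd ℂ) (inner ℂ φ ψ)) := by
    rw [mul_mul_mul_comm, Complex.mul_conj']; push_cast; ring
  rw [h3, h2, h1, PiLp.inner_apply]
  rw [← sum_mul_mul_mul]
  simp only [tensorVec, Fintype.sum_prod_type, RCLike.inner_apply, map_mul, starRingEnd_apply,
    star_star]
  refine Finset.sum_congr rfl fun i _ => Finset.sum_congr rfl fun j _ =>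
    Finset.sum_congr rfl fun k _ => Finset.sum_congr rfl fun l _ => ?_
  ring

lemma sum_symTensor_vec {c : Fin d → Fin d → Fin d → Fin d → ℂ} :
    ∑ i, ∑ j, ∑ k, ∑ l, symTensor d i j k l * c i j k l =
      (∑ i, ∑ j, (c i j i j + c i j j i)) / (d * (d + 1)) := by
  simp_rw [symTensor, Finset.sum_div]
  refine Finset.sum_congr rfl fun i _ => Finset.sum_congr rfl fun j _ => ?_
  simp [Matrix.one_apply, div_mul_eq_mul_div, add_mul, ← Finset.sum_div, Finset.sum_add_distrib]

lemma star_symTensor (i j k l : Fin d) : star (symTensor d i j k l) = symTensor d i j k l := by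
  simp only [symTensor, Matrix.one_apply]
  split_ifs <;> simp

lemma inner_symVec (w : EuclideanSpace ℂ (Fin d × Fin d × Fin d × Fin d)) :
    inner ℂ (symVec d) w =
      (∑ i, ∑ j, (w (i, j, i, j) + w (i, j, j, i))) / (d * (d + 1)) := by
  rw [← sum_symTensor_vec (c := fun i j k l => w (i, j, k, l)), PiLp.inner_apply]
  simp only [Fintype.sum_prod_type, symVec, RCLike.inner_apply, starRingEnd_apply,
    star_symTensor, mul_comm]

/-- The swap fixes `ψ ⊗ ψ`, so identity and swap each contribute `‖ψ‖⁴ = 1`. -/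
lemma inner_symVec_tensorVec {ψ : EuclideanSpace ℂ (Fin d)} (h : ‖ψ‖ = 1) :
    inner ℂ (symVec d) (tensorVec ψ) = 2 / (d * (d + 1)) := by
  have h1 := sum_mul_star_self ψ
  rw [h] at h1
  have h2 : ∑ i, ∑ j, (ψ i * star (ψ i)) * (ψ j * star (ψ j)) = 1 := by
    rw [← Finset.sum_mul_sum, h1]; simp
  rw [inner_symVec]
  congr 1
  simp only [tensorVec]
  rw [show (2 : ℂ) = 1 + 1 by norm_num]
  nth_rw 1 [← h2]
  rw [← h2, ← Finset.sum_add_distrib]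
  refine Finset.sum_congr rfl fun i _ => ?_
  rw [← Finset.sum_add_distrib]
  refine Finset.sum_congr rfl fun j _ => ?_
  ring

/-- A projection divided by its rank has squared Hilbert–Schmidt norm `1 / rank`. -/
lemma inner_symVec_self (hd : 1 ≤ d) : inner ℂ (symVec d) (symVec d) = 2 / (d * (d + 1)) := by
  have hd0 : (d : ℂ) ≠ 0 := by exact_mod_cast (by omega : d ≠ 0)
  have hd1 : (d : ℂ) + 1 ≠ 0 := by exact_mod_cast (by omega : d + 1 ≠ 0)
  rw [inner_symVec]
  simp [symVec, symTensor, Matrix.one_apply, Finset.sum_add_distrib, ← Finset.sum_div,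
    ← add_div]
  field_simp
  ring

lemma sum_symTensor_diag (hd : 1 ≤ d) (i k : Fin d) :
    ∑ j, symTensor d i j k j = (1 : Op d) i k / d := by
  have hd0 : (d : ℂ) ≠ 0 := by exact_mod_cast (by omega : d ≠ 0)
  have hd1 : (d : ℂ) + 1 ≠ 0 := by exact_mod_cast (by omega : d + 1 ≠ 0)
  simp only [symTensor, ← Finset.sum_div, Finset.sum_add_distrib, Matrix.one_apply]
  by_cases h : i = k <;> simp [h]
  field_simp

variable {Ω : Type*} [MeasurableSpace Ω] {P : Measure Ω} [IsProbabilityMeasure P]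
  {ψ : Ω → EuclideanSpace ℂ (Fin d)}

lemma norm_apply_le_one {φ : EuclideanSpace ℂ (Fin d)} (h : ‖φ‖ = 1) (i : Fin d) :
    ‖φ i‖ ≤ 1 := h ▸ PiLp.norm_apply_le φ i

lemma integrable_tensor (hψ : Measurable ψ) (h1 : ∀ ω, ‖ψ ω‖ = 1) (i j k l : Fin d) :
    Integrable (fun ω => ψ ω i * ψ ω j * star (ψ ω k) * star (ψ ω l)) P := by
  have hm : ∀ i, Measurable fun ω => ψ ω i := fun i =>
    (by fun_prop : Continuous fun x : EuclideanSpace ℂ (Fin d) => x i).measurable.comp hψ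
  refine .of_bound (C := 1) ?_ (.of_forall fun ω => ?_)
  · exact ((((hm i).mul (hm j)).mul (continuous_star.measurable.comp (hm k))).mul
      (continuous_star.measurable.comp (hm l))).aestronglyMeasurable
  · simp only [norm_mul, norm_star]
    have := norm_apply_le_one (h1 ω)
    have h2 := mul_le_one₀ (this i) (norm_nonneg _) (this j)
    have h3 := mul_le_one₀ h2 (norm_nonneg _) (this k)
    exact mul_le_one₀ h3 (norm_nonneg _) (this l)

/-- A distribution of unit vectors with the least possible frame potential has the second moment
of the uniform distribution. -/
theorem integral_tensor_eq (hd : 1 ≤ d) (hψ : Measurable ψ) (h1 : ∀ ω, ‖ψ ω‖ = 1)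
    (hF : ∫ ω, ∫ ω', ‖inner ℂ (ψ ω) (ψ ω')‖ ^ 4 ∂P ∂P = 2 / (d * (d + 1))) (i j k l : Fin d) :
    ∫ ω, ψ ω i * ψ ω j * star (ψ ω k) * star (ψ ω l) ∂P = symTensor d i j k l := by
  have hv : Integrable (fun ω => tensorVec (ψ ω)) P := by
    have hc : Continuous (tensorVec (d := d)) := by unfold tensorVec; fun_prop
    refine .of_bound (C := 1) (hc.measurable.comp hψ).aestronglyMeasurable (.of_forall fun ω => ?_)
    have h2 := inner_tensorVec (ψ ω) (ψ ω)
    rw [inner_self_eq_norm_sq_to_K, inner_self_eq_norm_sq_to_K, h1] at h2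
    have h3 : ‖tensorVec (ψ ω)‖ ^ 2 = 1 := by
      apply Complex.ofReal_injective
      simpa using h2
    exact by nlinarith [norm_nonneg (tensorVec (ψ ω))]
  have h := integral_eq_of_inner_eq hv (S := symVec d) (s := 2 / (d * (d + 1))) ?_
    (fun ω => inner_symVec_tensorVec (h1 ω)) (inner_symVec_self hd)
  · have h2 := congrArg (fun w => w (i, j, k, l)) h
    simp only [symVec] at h2
    rw [← h2]
    exact (ContinuousLinearMap.integral_comp_comm
      (EuclideanSpace.proj (𝕜 := ℂ) (i, j, k, l) :
        EuclideanSpace ℂ (Fin d × Fin d × Fin d × Fin d) →L[ℂ] ℂ) hv)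
  · simp_rw [inner_tensorVec, integral_complex_ofReal, hF]
    push_cast; rfl

/-- For unit vectors the first moment is the partial trace of the second. -/
theorem integral_mul_star_eq (hd : 1 ≤ d) (hψ : Measurable ψ) (h1 : ∀ ω, ‖ψ ω‖ = 1)
    (hF : ∫ ω, ∫ ω', ‖inner ℂ (ψ ω) (ψ ω')‖ ^ 4 ∂P ∂P = 2 / (d * (d + 1))) (i k : Fin d) :
    ∫ ω, ψ ω i * star (ψ ω k) ∂P = (1 : Op d) i k / d := by
  rw [← sum_symTensor_diag hd]
  simp_rw [← integral_tensor_eq hd hψ h1 hF]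
  rw [← integral_finsetSum _ fun j _ => integrable_tensor hψ h1 i j k j]
  refine integral_congr_ae (.of_forall fun ω => ?_)
  have h2 := sum_mul_star_self (ψ ω)
  rw [h1] at h2
  simp only
  calc ψ ω i * star (ψ ω k) = ψ ω i * star (ψ ω k) * ∑ j, ψ ω j * star (ψ ω j) := by
        rw [h2]; simp
    _ = _ := by
        rw [Finset.mul_sum]
        exact Finset.sum_congr rfl fun j _ => by ring

end Frame

/-! ### Moments of the uniform measure on the sphere -/

section Sphere

open scoped Pointwise

variable {d : ℕ}

/-- A linear isometry, as a map of the unit sphere. -/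
noncomputable def sphereMap (U : EuclideanSpace ℂ (Fin d) ≃ₗᵢ[ℂ] EuclideanSpace ℂ (Fin d))
    (ψ : Metric.sphere (0 : EuclideanSpace ℂ (Fin d)) 1) :
    Metric.sphere (0 : EuclideanSpace ℂ (Fin d)) 1 :=
  ⟨U ψ, by simp⟩

lemma continuous_sphereMap (U : EuclideanSpace ℂ (Fin d) ≃ₗᵢ[ℂ] EuclideanSpace ℂ (Fin d)) :
    Continuous (sphereMap U) :=
  (U.continuous.comp continuous_subtype_val).subtype_mk _

/-- The surface measure of a set is a multiple of the volume of the cone over it; a unitary commutes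
with dilations and preserves volume. -/
lemma map_sphereMap_toSphere
    (U : EuclideanSpace ℂ (Fin d) ≃ₗᵢ[ℂ] EuclideanSpace ℂ (Fin d)) :
    (volume : Measure (EuclideanSpace ℂ (Fin d))).toSphere.map (sphereMap U) =
      (volume : Measure (EuclideanSpace ℂ (Fin d))).toSphere := by
  ext s hs
  have hm := (continuous_sphereMap U).measurable
  rw [Measure.map_apply hm hs, Measure.toSphere_apply' _ (hm hs), Measure.toSphere_apply' _ hs]
  congr 1
  let V : EuclideanSpace ℂ (Fin d) ≃ₗᵢ[ℝ] EuclideanSpace ℂ (Fin d) :=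
    { U.toLinearEquiv.restrictScalars ℝ with norm_map' := U.norm_map }
  rw [← V.measurePreserving.measure_preimage_equiv
    (f := V.toHomeomorph.toMeasurableEquiv) (Set.Ioo (0 : ℝ) 1 • (Subtype.val '' s))]
  congr 1
  ext x
  simp only [Set.mem_smul, Set.mem_image, Set.mem_preimage]
  constructor
  · rintro ⟨t, ht, _, ⟨ψ, hψ, rfl⟩, rfl⟩
    exact ⟨t, ht, _, ⟨_, hψ, rfl⟩, (V.map_smul t _).symm⟩
  · rintro ⟨t, ht, _, ⟨ψ, hψ, rfl⟩, h⟩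
    refine ⟨t, ht, U.symm ψ, ⟨⟨U.symm ψ, by simp⟩, ?_, rfl⟩, ?_⟩
    · convert hψ
      simp [sphereMap]
    · apply V.injective
      refine Eq.trans ?_ h
      rw [V.map_smul]
      congr 1
      exact U.apply_symm_apply _

instance isProbabilityMeasure_uniformMeasure [NeZero d] :
    IsProbabilityMeasure (uniformMeasure d) := by
  have : Nonempty (Fin d) := ⟨0⟩
  refine ⟨?_⟩
  rw [uniformMeasure, Measure.smul_apply, smul_eq_mul]
  refine ENNReal.inv_mul_cancel ?_ (measure_ne_top _ _)
  rw [Measure.measure_univ_ne_zero]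
  exact Measure.toSphere_ne_zero _

lemma integral_sphereMap (U : EuclideanSpace ℂ (Fin d) ≃ₗᵢ[ℂ] EuclideanSpace ℂ (Fin d))
    {g : Metric.sphere (0 : EuclideanSpace ℂ (Fin d)) 1 → ℝ} (hg : Continuous g) :
    ∫ ψ, g (sphereMap U ψ) ∂(uniformMeasure d) = ∫ ψ, g ψ ∂(uniformMeasure d) := by
  have h : (uniformMeasure d).map (sphereMap U) = uniformMeasure d := by
    rw [uniformMeasure, Measure.map_smul, map_sphereMap_toSphere]
  conv_rhs => rw [← h]
  rw [integral_map (continuous_sphereMap U).aemeasurable hg.aestronglyMeasurable]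

/-- By unitary invariance, the mean of `|⟨φ, ψ⟩|⁴` is the same for all unit vectors `φ`. -/
lemma integral_norm_inner_pow_eq [NeZero d] {φ : EuclideanSpace ℂ (Fin d)} (h : ‖φ‖ = 1) :
    ∫ ψ, ‖inner ℂ φ (ψ : EuclideanSpace ℂ (Fin d))‖ ^ 4 ∂(uniformMeasure d) =
      ∫ ψ, ‖(ψ : EuclideanSpace ℂ (Fin d)) 0‖ ^ 4 ∂(uniformMeasure d) := by
  -- Complete `φ` to an orthonormal basis having it at index `0`; the coordinate map is then a
  -- unitary that turns `⟨φ, ψ⟩` into the coordinate `0`.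
  have ho : Orthonormal ℂ (({0} : Set (Fin d)).domRestrict fun _ : Fin d => φ) := by
    refine ⟨fun _ => h, fun i j hij => absurd (Subsingleton.elim i j) hij⟩
  obtain ⟨b, hb⟩ := ho.exists_orthonormalBasis_extension_of_card_eq (by simp)
  have hb0 : b 0 = φ := hb 0 rfl
  rw [← integral_sphereMap b.repr (g := fun ψ => ‖(ψ : EuclideanSpace ℂ (Fin d)) 0‖ ^ 4)
    (by fun_prop)]
  simp [sphereMap, b.repr_apply_apply, hb0]

lemma integral_norm_apply_pow_eq [NeZero d] (k : Fin d) :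
    ∫ ψ, ‖(ψ : EuclideanSpace ℂ (Fin d)) k‖ ^ 4 ∂(uniformMeasure d) =
      ∫ ψ, ‖(ψ : EuclideanSpace ℂ (Fin d)) 0‖ ^ 4 ∂(uniformMeasure d) := by
  rw [← integral_norm_inner_pow_eq (φ := EuclideanSpace.single k 1) (by simp)]
  simp [EuclideanSpace.inner_single_left]

lemma integrable_of_continuous [NeZero d]
    {g : Metric.sphere (0 : EuclideanSpace ℂ (Fin d)) 1 → ℝ} (hg : Continuous g) :
    Integrable g (uniformMeasure d) :=
  hg.integrable_of_hasCompactSupport (HasCompactSupport.of_compactSpace _)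

/-- Summing `‖z + u w‖⁴` over the fourth roots of unity `u` removes the phase-dependent terms. -/
lemma norm_add_pow_four (z w : ℂ) :
    ‖z + w‖ ^ 4 + ‖z - w‖ ^ 4 + ‖z + Complex.I * w‖ ^ 4 + ‖z - Complex.I * w‖ ^ 4 =
      4 * (‖z‖ ^ 4 + ‖w‖ ^ 4 + 4 * (‖z‖ ^ 2 * ‖w‖ ^ 2)) := by
  have h4 : ∀ u : ℂ, ‖u‖ ^ 4 = (u.re ^ 2 + u.im ^ 2) ^ 2 := fun u => by
    rw [show ‖u‖ ^ 4 = (‖u‖ ^ 2) ^ 2 by ring, Complex.sq_norm, Complex.normSq_apply]; ring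
  have h2 : ∀ u : ℂ, ‖u‖ ^ 2 = u.re ^ 2 + u.im ^ 2 := fun u => by
    rw [Complex.sq_norm, Complex.normSq_apply]; ring
  simp only [h4, h2]
  simp
  ring

/-- Each `ψ i + u ψ j` with `‖u‖ = 1` is `√2` times an overlap with a unit vector, so its fourth
moment is `4c`. Summing over the four roots of unity, `16c = 4(2c + 4m)` with `m` the mixed moment.
-/
lemma integral_norm_sq_mul [NeZero d] {i j : Fin d} (hij : i ≠ j) :
    2 * ∫ ψ, ‖(ψ : EuclideanSpace ℂ (Fin d)) i‖ ^ 2 * ‖(ψ : EuclideanSpace ℂ (Fin d)) j‖ ^ 2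
        ∂(uniformMeasure d) =
      ∫ ψ, ‖(ψ : EuclideanSpace ℂ (Fin d)) 0‖ ^ 4 ∂(uniformMeasure d) := by
  set c := ∫ ψ, ‖(ψ : EuclideanSpace ℂ (Fin d)) 0‖ ^ 4 ∂(uniformMeasure d) with hc
  have hcoord : ∀ k : Fin d,
      ∫ ψ, ‖(ψ : EuclideanSpace ℂ (Fin d)) k‖ ^ 4 ∂(uniformMeasure d) = c :=
    integral_norm_apply_pow_eq
  have hcomb : ∀ u : ℂ, ‖u‖ = 1 →
      ∫ ψ, ‖(ψ : EuclideanSpace ℂ (Fin d)) i + u * (ψ : EuclideanSpace ℂ (Fin d)) j‖ ^ 4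
        ∂(uniformMeasure d) = 4 * c := fun u hu => by
    set χ : EuclideanSpace ℂ (Fin d) :=
      EuclideanSpace.single i 1 + EuclideanSpace.single j (star u) with hχ
    have hχ2 : ‖χ‖ ^ 2 = 2 := by
      rw [hχ, norm_add_sq (𝕜 := ℂ), EuclideanSpace.inner_single_left]
      simp [hij, hu]
      norm_num
    have hχ0 : ‖χ‖ ≠ 0 := fun h => by rw [h] at hχ2; norm_num at hχ2
    have h1 := integral_norm_inner_pow_eq (φ := ((‖χ‖⁻¹ : ℝ) : ℂ) • χ)
      (by rw [norm_smul, Complex.norm_real, norm_inv, norm_norm, inv_mul_cancel₀ hχ0])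
    have h2 : ∀ ψ : EuclideanSpace ℂ (Fin d), ‖inner ℂ (((‖χ‖⁻¹ : ℝ) : ℂ) • χ) ψ‖ ^ 4 =
        4⁻¹ * ‖ψ i + u * ψ j‖ ^ 4 := fun ψ => by
      have h3 : inner ℂ χ ψ = ψ i + u * ψ j := by
        simp [hχ, EuclideanSpace.inner_single_left]
      rw [inner_smul_left, h3, norm_mul, mul_pow, RCLike.norm_conj, Complex.norm_real, norm_inv,
        norm_norm, inv_pow, show ‖χ‖ ^ 4 = (‖χ‖ ^ 2) ^ 2 by ring, hχ2]
      norm_num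
    simp_rw [h2] at h1
    rw [integral_const_mul, ← hc] at h1
    linarith
  have hsum : ∫ ψ : Metric.sphere (0 : EuclideanSpace ℂ (Fin d)) 1,
      4 * (‖(ψ : EuclideanSpace ℂ (Fin d)) i‖ ^ 4 + ‖(ψ : EuclideanSpace ℂ (Fin d)) j‖ ^ 4 +
        4 * (‖(ψ : EuclideanSpace ℂ (Fin d)) i‖ ^ 2 * ‖(ψ : EuclideanSpace ℂ (Fin d)) j‖ ^ 2))
        ∂(uniformMeasure d) = 16 * c := by
    simp_rw [← norm_add_pow_four]
    rw [integral_add, integral_add, integral_add]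
    · have e1 := hcomb 1 (by simp)
      have e2 := hcomb (-1) (by simp)
      have e3 := hcomb Complex.I (by simp)
      have e4 := hcomb (-Complex.I) (by simp)
      simp only [one_mul, neg_mul, ← sub_eq_add_neg] at e1 e2 e3 e4
      rw [e1, e2, e3, e4]; ring
    all_goals exact integrable_of_continuous (by fun_prop)
  rw [integral_const_mul, integral_add, integral_add, integral_const_mul, hcoord, hcoord] at hsum
  · linarith
  all_goals exact integrable_of_continuous (by fun_prop)

/-- Expanding `1 = (∑ ‖ψ i‖²)²` and integrating gives `1 = d c + d(d-1) c/2`. -/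
lemma integral_coord_pow_four [NeZero d] :
    ∫ ψ, ‖(ψ : EuclideanSpace ℂ (Fin d)) 0‖ ^ 4 ∂(uniformMeasure d) =
      2 / ((d : ℝ) * (d + 1)) := by
  set c := ∫ ψ, ‖(ψ : EuclideanSpace ℂ (Fin d)) 0‖ ^ 4 ∂(uniformMeasure d) with hc
  have hcoord : ∀ k : Fin d,
      ∫ ψ, ‖(ψ : EuclideanSpace ℂ (Fin d)) k‖ ^ 4 ∂(uniformMeasure d) = c :=
    integral_norm_apply_pow_eq
  have hpair : ∀ i j : Fin d, ∫ ψ, ‖(ψ : EuclideanSpace ℂ (Fin d)) i‖ ^ 2 *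
      ‖(ψ : EuclideanSpace ℂ (Fin d)) j‖ ^ 2 ∂(uniformMeasure d) =
        c / 2 + if i = j then c / 2 else 0 := fun i j => by
    split_ifs with h
    · subst h
      rw [add_halves, ← hcoord i]
      refine integral_congr_ae (.of_forall fun ψ => ?_)
      simp only
      ring
    · linarith [integral_norm_sq_mul h]
  have h1 : ∫ ψ : Metric.sphere (0 : EuclideanSpace ℂ (Fin d)) 1, ∑ i, ∑ j,
      ‖(ψ : EuclideanSpace ℂ (Fin d)) i‖ ^ 2 * ‖(ψ : EuclideanSpace ℂ (Fin d)) j‖ ^ 2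
        ∂(uniformMeasure d) = 1 := by
    have : ∀ ψ : Metric.sphere (0 : EuclideanSpace ℂ (Fin d)) 1, ∑ i, ∑ j,
      ‖(ψ : EuclideanSpace ℂ (Fin d)) i‖ ^ 2 * ‖(ψ : EuclideanSpace ℂ (Fin d)) j‖ ^ 2 = 1 :=
      fun ψ => by
        rw [← Finset.sum_mul_sum, ← EuclideanSpace.norm_sq_eq]
        simp
    simp [this]
  rw [integral_finsetSum _ fun i _ => integrable_of_continuous (by fun_prop)] at h1
  have h2 : ∀ i, ∫ ψ : Metric.sphere (0 : EuclideanSpace ℂ (Fin d)) 1, ∑ j,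
      ‖(ψ : EuclideanSpace ℂ (Fin d)) i‖ ^ 2 * ‖(ψ : EuclideanSpace ℂ (Fin d)) j‖ ^ 2
        ∂(uniformMeasure d) = ∑ j, (c / 2 + if i = j then c / 2 else 0) := fun i => by
    rw [integral_finsetSum _ fun j _ => integrable_of_continuous (by fun_prop)]
    exact Finset.sum_congr rfl fun j _ => hpair i j
  simp_rw [h2] at h1
  simp [Finset.sum_add_distrib] at h1
  have hd : (0 : ℝ) < d := by exact_mod_cast Nat.pos_of_ne_zero (NeZero.ne d)
  rw [eq_div_iff (by positivity)]
  linarith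

lemma uniform_frame [NeZero d] :
    ∫ ψ : Metric.sphere (0 : EuclideanSpace ℂ (Fin d)) 1,
      ∫ χ : Metric.sphere (0 : EuclideanSpace ℂ (Fin d)) 1,
        ‖inner ℂ (ψ : EuclideanSpace ℂ (Fin d)) (χ : EuclideanSpace ℂ (Fin d))‖ ^ 4
        ∂(uniformMeasure d) ∂(uniformMeasure d) = 2 / ((d : ℝ) * (d + 1)) := by
  have : ∀ ψ : Metric.sphere (0 : EuclideanSpace ℂ (Fin d)) 1,
      ‖(ψ : EuclideanSpace ℂ (Fin d))‖ = 1 := fun ψ => by simp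
  simp_rw [integral_norm_inner_pow_eq (this _), integral_coord_pow_four]
  simp

lemma tr_ketbra (ψ : EuclideanSpace ℂ (Fin d)) : tr (ketbra ψ) = ‖ψ‖ ^ 2 := by
  have h := sum_mul_star_self ψ
  rw [← Complex.ofReal_pow] at h
  rw [← Complex.ofReal_re (‖ψ‖ ^ 2), ← h]
  rfl

lemma moment_two_uniform (hd : 1 ≤ d) (i j k l : Fin d) :
    moment 2 (uniformMeasure d) (uniformEnsemble d) ![i, j] ![k, l] = symTensor d i j k l := by
  have : NeZero d := ⟨by omega⟩
  rw [moment_two_apply, ← integral_tensor_eq hd measurable_subtype_coe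
    (fun ψ : Metric.sphere (0 : EuclideanSpace ℂ (Fin d)) 1 => by simp) uniform_frame]
  refine integral_congr_ae (.of_forall fun ψ => ?_)
  simp only [uniformEnsemble, tr_ketbra]
  simp [ketbra, Matrix.vecMulVec_apply]
  ring

lemma moment_one_uniform (hd : 1 ≤ d) (i k : Fin d) :
    moment 1 (uniformMeasure d) (uniformEnsemble d) ![i] ![k] = (1 : Op d) i k / d := by
  have : NeZero d := ⟨by omega⟩
  rw [moment_one_apply, ← integral_mul_star_eq hd measurable_subtype_coe
    (fun ψ : Metric.sphere (0 : EuclideanSpace ℂ (Fin d)) 1 => by simp) uniform_frame]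
  rfl

end Sphere

/-! ### Finite designs: SICs and MUBs -/

section FiniteDesign

variable {d : ℕ} {ι : Type*} [Fintype ι] [MeasurableSpace ι] [MeasurableSingletonClass ι]

lemma posSemidef_ketbra (φ : EuclideanSpace ℂ (Fin d)) : (ketbra φ).PosSemidef :=
  Matrix.posSemidef_vecMulVec_self_star _

lemma ketbra_apply (φ : EuclideanSpace ℂ (Fin d)) (i j : Fin d) :
    ketbra φ i j = φ i * star (φ j) := rfl

lemma tr_smul (r : ℝ) (A : Op d) : tr ((r : ℂ) • A) = r * tr A := by
  simp [tr, Matrix.trace_smul]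

/-- A finite family of unit vectors with the least possible frame potential is a 2-design. -/
theorem isDesignPOVM_of_frame (hd : 1 ≤ d) {φ : ι → EuclideanSpace ℂ (Fin d)}
    (h1 : ∀ a, ‖φ a‖ = 1) {N : ℝ} (hN : 0 < N) (hcard : Fintype.card ι = N)
    (hF : ∀ a, ∑ b, ‖inner ℂ (φ a) (φ b)‖ ^ 4 = N * (2 / (d * (d + 1)))) :
    IsDesignPOVM 2 Measure.count fun a => ((d / N : ℝ) : ℂ) • ketbra (φ a) := by
  have hdC : (d : ℂ) ≠ 0 := by exact_mod_cast (by omega : d ≠ 0)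
  have hNC : (N : ℂ) ≠ 0 := by exact_mod_cast hN.ne'
  have hdR : (0 : ℝ) < d := by exact_mod_cast hd
  let P : Measure ι := ENNReal.ofReal N⁻¹ • Measure.count
  have hP : IsProbabilityMeasure P := by
    refine ⟨?_⟩
    rw [Measure.smul_apply, Measure.count_univ, ENat.card_eq_coe_fintype_card, smul_eq_mul]
    have : ((Fintype.card ι : ℕ∞) : ℝ≥0∞) = ENNReal.ofReal N := by
      rw [← hcard, ENNReal.ofReal_natCast]; rfl
    rw [this, ← ENNReal.ofReal_mul (by positivity), inv_mul_cancel₀ hN.ne', ENNReal.ofReal_one]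
  have hint : ∀ {E : Type} [NormedAddCommGroup E] [NormedSpace ℝ E] [CompleteSpace E]
      (g : ι → E), ∫ a, g a ∂P = N⁻¹ • ∑ a, g a := fun g => by
    rw [integral_smul_measure, integral_count, ENNReal.toReal_ofReal (by positivity)]
  have hFP : ∫ a, ∫ b, ‖inner ℂ (φ a) (φ b)‖ ^ 4 ∂P ∂P = 2 / ((d : ℝ) * (d + 1)) := by
    simp_rw [hint, hF, Finset.sum_const, Finset.card_univ, smul_eq_mul, nsmul_eq_mul, hcard]
    field_simp
  have hm1 := integral_mul_star_eq (P := P) hd (measurable_of_finite φ) h1 hFP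
  have hm2 := integral_tensor_eq (P := P) hd (measurable_of_finite φ) h1 hFP
  simp_rw [hint] at hm1 hm2
  have htr : ∀ a, tr (ketbra (φ a)) = 1 := fun a => by rw [tr_ketbra, h1]; norm_num
  have hω : ∀ a, (d : ℂ)⁻¹ • (((d / N : ℝ) : ℂ) • ketbra (φ a)) =
      ((N⁻¹ : ℝ) : ℂ) • ketbra (φ a) := fun a => by
    rw [smul_smul]; congr 1; push_cast; field_simp
  have hpos : ∀ {r : ℝ}, 0 ≤ r → ∀ a, (((r : ℂ)) • ketbra (φ a)).PosSemidef := fun hr a =>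
    (posSemidef_ketbra (φ a)).smul (by exact_mod_cast hr)
  -- Completeness is the first-moment identity multiplied by `d`.
  have hsum : ∑ a, ((d / N : ℝ) : ℂ) • ketbra (φ a) = 1 := by
    ext i j
    have := hm1 i j
    rw [Matrix.sum_apply]
    simp only [Matrix.smul_apply, smul_eq_mul, ketbra_apply, ← Finset.mul_sum]
    rw [eq_div_iff hdC] at this
    rw [← this, Complex.real_smul]
    push_cast
    ring
  have hens : IsEnsemble Measure.count fun a =>
      (d : ℂ)⁻¹ • (((d / N : ℝ) : ℂ) • ketbra (φ a)) := by
    simp_rw [hω]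
    have hcard1 : (1 : ℝ) ≤ N := by
      have : 0 < Fintype.card ι := by
        rw [← hcard] at hN; exact_mod_cast hN
      rw [← hcard]; exact_mod_cast this
    refine ⟨fun i j => measurable_of_finite _, fun a => ⟨hpos (by positivity) a, ?_⟩, ?_⟩
    · rw [tr_smul, htr, mul_one]; exact inv_le_one_of_one_le₀ hcard1
    · simp_rw [tr_smul, htr, mul_one]
      rw [lintegral_const]
      exact hP.measure_univ
  refine ⟨⟨fun i j => measurable_of_finite _, fun a => ⟨hpos (by positivity) a, ?_⟩,
    fun i j => .of_finite, fun i j => ?_⟩, hens, fun k hk1 hk2 => ?_⟩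
  -- `1 - π a` is the sum of the other elements, hence positive.
  · classical
    rw [← hsum, ← Finset.sum_erase_eq_sub (Finset.mem_univ a)]
    exact Matrix.posSemidef_sum _ fun b _ => hpos (by positivity) b
  · rw [integral_count, ← hsum, Matrix.sum_apply]
  · simp_rw [hω]
    obtain rfl | rfl : k = 1 ∨ k = 2 := by omega
    · ext i k
      rw [show i = ![i 0] from by ext x; fin_cases x; rfl,
        show k = ![k 0] from by ext x; fin_cases x; rfl, moment_one_uniform hd,
        moment_one_apply, integral_count, ← hm1, Complex.real_smul]
      simp only [Matrix.smul_apply, smul_eq_mul, ketbra_apply, ← Finset.mul_sum]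
    · ext i k
      rw [show i = ![i 0, i 1] from by ext x; fin_cases x <;> rfl,
        show k = ![k 0, k 1] from by ext x; fin_cases x <;> rfl, moment_two_uniform hd,
        moment_two_apply, integral_count, ← hm2, Complex.real_smul, Finset.mul_sum]
      refine Finset.sum_congr rfl fun a _ => ?_
      rw [tr_smul, htr]
      simp only [Matrix.smul_apply, smul_eq_mul, ketbra_apply]
      push_cast
      field_simp

/-- Each vector has overlap sum `1 + (d² - 1)/(d+1)² = 2d/(d+1)`. -/
theorem isDesignPOVM_sicPOVM (hd : 1 ≤ d) {φ : Fin (d ^ 2) → EuclideanSpace ℂ (Fin d)}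
    (h : IsSIC φ) : IsDesignPOVM 2 Measure.count (sicPOVM φ) := by
  have hdR : (0 : ℝ) < d := by exact_mod_cast hd
  have key := isDesignPOVM_of_frame hd h.norm_eq_one (N := (d : ℝ) ^ 2) (by positivity) (by simp)
    fun a => ?_
  · convert key using 3
    rw [sicPOVM]
    congr 1
    push_cast
    have : (d : ℂ) ≠ 0 := by exact_mod_cast hdR.ne'
    field_simp
  · have h4 : ∀ b, ‖inner ℂ (φ a) (φ b)‖ ^ 4 =
        1 / ((d : ℝ) + 1) ^ 2 + if a = b then 1 - 1 / ((d : ℝ) + 1) ^ 2 else 0 := fun b => by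
      split_ifs with hab
      · subst hab
        rw [inner_self_eq_norm_sq_to_K, h.norm_eq_one]
        simp
      · rw [show ‖inner ℂ (φ a) (φ b)‖ ^ 4 = (‖inner ℂ (φ a) (φ b)‖ ^ 2) ^ 2 by ring,
          h.overlap a b hab, div_pow, one_pow, add_zero]
    simp_rw [h4, Finset.sum_add_distrib]
    simp
    field_simp
    ring

/-- Each vector has overlap sum `2`: its own basis gives `1`, and the `d` others give `d · 1/d²`
each. -/
theorem isDesignPOVM_mubPOVM (hd : 1 ≤ d)
    {b : Fin (d + 1) → OrthonormalBasis (Fin d) ℂ (EuclideanSpace ℂ (Fin d))}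
    (h : IsCompleteMUB b) : IsDesignPOVM 2 Measure.count (mubPOVM b) := by
  have hdR : (0 : ℝ) < d := by exact_mod_cast hd
  have key := isDesignPOVM_of_frame hd (φ := fun z : Fin (d + 1) × Fin d => b z.1 z.2)
    (fun z => (b z.1).orthonormal.1 z.2) (N := ((d : ℝ) + 1) * d) (by positivity) (by simp)
    fun a => ?_
  · convert key using 3 with z
    rw [mubPOVM]
    congr 1
    push_cast
    have h0 : (d : ℂ) ≠ 0 := by exact_mod_cast hdR.ne'
    have h1 : (d : ℂ) + 1 ≠ 0 := by exact_mod_cast (by omega : d + 1 ≠ 0)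
    field_simp
  · have h4 : ∀ m j, ‖inner ℂ (b a.1 a.2) (b m j)‖ ^ 4 =
        if a.1 = m then (if a.2 = j then (1 : ℝ) else 0) else 1 / (d : ℝ) ^ 2 := fun m j => by
      split_ifs with hm hj
      · subst hm hj
        rw [inner_self_eq_norm_sq_to_K, (b a.1).orthonormal.1]
        simp
      · subst hm
        rw [(b a.1).orthonormal.2 hj]
        simp
      · rw [show ‖inner ℂ (b a.1 a.2) (b m j)‖ ^ 4 = (‖inner ℂ (b a.1 a.2) (b m j)‖ ^ 2) ^ 2 by
          ring, h _ _ hm]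
        ring
    have h5 : ∀ m, ∑ j, ‖inner ℂ (b a.1 a.2) (b m j)‖ ^ 4 =
        1 / d + if a.1 = m then 1 - 1 / (d : ℝ) else 0 := fun m => by
      simp_rw [h4]
      split_ifs with hm
      · simp
      · simp
        field_simp
    rw [Fintype.sum_prod_type]
    simp only
    simp_rw [h5, Finset.sum_add_distrib]
    simp
    field_simp
    ring

end FiniteDesign

/-! ### Interpolation bounds and the limit -/

section Bounds

variable {d : ℕ}

theorem IsDesignPOVM.informationalPower_le {Y : Type*} [MeasurableSpace Y] {ν : Measure Y}
    [SigmaFinite ν] {π : Y → Op d} (hd : 1 ≤ d) (h : IsDesignPOVM 2 ν π) :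
    informationalPower ν π ≤ ENNReal.ofReal (W₂ d) :=
  QuantumDesign.informationalPower_le hd h.1 h.2.1 fun i j k l => by
    rw [h.2.2 2 (by norm_num) le_rfl, moment_two_uniform hd]

lemma interpolationBound_two (hd : 1 ≤ d) (p : Polynomial ℝ) :
    interpolationBound d 2 p = Real.log d - p.coeff 1 - 2 / ((d : ℝ) + 1) * p.coeff 2 := by
  have hdR : (0 : ℝ) < d := by exact_mod_cast hd
  have h2 : ((Nat.choose (d + 2 - 1) 2 : ℕ) : ℝ) = d * (d + 1) / 2 := by
    rw [Nat.cast_choose_two]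
    simp; ring
  rw [interpolationBound, show Finset.Icc 1 2 = {1, 2} from rfl,
    Finset.sum_pair (by norm_num), h2]
  simp
  field_simp
  ring

lemma IsInterpolant.coeff_eq {x : Fin (2 / 2) → ℝ} {p : Polynomial ℝ} (h : IsInterpolant 2 x p) :
    ∃ s ∈ Set.Ioo (0 : ℝ) 1, p.coeff 1 = 1 - Real.log s ∧ p.coeff 2 = -s⁻¹ := by
  obtain ⟨h0, h1⟩ := h.mem_Ioo ⟨0, by norm_num⟩
  have he := h.eval_node ⟨0, by norm_num⟩
  have hd := h.deriv_node ⟨0, by norm_num⟩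
  set s := x ⟨0, by norm_num⟩
  refine ⟨s, ⟨h0, h1⟩, ?_⟩
  have hp : p = Polynomial.C (p.coeff 2) * Polynomial.X ^ 2 +
      Polynomial.C (p.coeff 1) * Polynomial.X := by
    conv_lhs => rw [Polynomial.eq_quadratic_of_degree_le_two
      (Polynomial.natDegree_le_iff_degree_le.1 h.natDegree_le), h.coeff_zero]
    simp
  rw [hp] at he hd
  rw [Real.deriv_negMulLog h0.ne'] at hd
  simp [Real.negMulLog] at he hd
  -- The combination `s p'(s) - p(s)` eliminates the linear coefficient.
  have e2 : s * (p.coeff 2 * s + 1) = 0 := by linear_combination s * hd - he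
  have e3 : p.coeff 2 * s = -1 := by
    rcases mul_eq_zero.1 e2 with h | h <;> linarith
  refine ⟨by linarith, ?_⟩
  field_simp
  linarith

lemma W₂_le_interpolationBound (hd : 1 ≤ d) {x : Fin (2 / 2) → ℝ} {p : Polynomial ℝ}
    (h : IsInterpolant 2 x p) : W₂ d ≤ interpolationBound d 2 p := by
  have hdR : (0 : ℝ) < d := by exact_mod_cast hd
  obtain ⟨s, ⟨hs, -⟩, h1, h2⟩ := h.coeff_eq
  rw [interpolationBound_two hd, h1, h2, W₂]
  -- The gap between the two sides is `u - 1 - log u` for this ratio `u`.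
  have h3 := Real.log_le_sub_one_of_pos (show 0 < 2 / ((d : ℝ) + 1) / s by positivity)
  rw [show 2 * (d : ℝ) / (d + 1) = d * (2 / (d + 1) / s) * s by field_simp,
    Real.log_mul (by positivity) hs.ne', Real.log_mul hdR.ne' (by positivity)]
  rw [div_eq_mul_inv _ s] at h3 ⊢
  linarith

lemma exists_interpolant (hd : 2 ≤ d) :
    ∃ p, IsInterpolant 2 (fun _ => 2 / ((d : ℝ) + 1)) p ∧ interpolationBound d 2 p = W₂ d := by
  have hdR : (2 : ℝ) ≤ d := by exact_mod_cast hd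
  have hs : 0 < 2 / ((d : ℝ) + 1) := by positivity
  have hs1 : 2 / ((d : ℝ) + 1) < 1 := by rw [div_lt_one (by positivity)]; linarith
  set s := 2 / ((d : ℝ) + 1) with hsd
  refine ⟨Polynomial.C (-s⁻¹) * Polynomial.X ^ 2 + Polynomial.C (1 - Real.log s) * Polynomial.X,
    ⟨?_, fun _ => ⟨hs, hs1⟩, by compute_degree, by simp, fun h => absurd h (by decide),
      fun _ => ?_, fun _ => ?_⟩, ?_⟩
  · intro a b hab
    -- `Fin (2 / 2)` has a single element, so strict monotonicity is vacuous.
    exact absurd hab (by have := a.2; have := b.2; rw [Fin.lt_def]; omega)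
  · simp [Real.negMulLog]
    field_simp
    ring
  · rw [Real.deriv_negMulLog hs.ne']
    simp
    field_simp
    ring
  · rw [interpolationBound_two (by omega), W₂,
      show 2 * (d : ℝ) / (d + 1) = d * s by rw [hsd]; ring,
      Real.log_mul (by positivity) hs.ne', ← hsd]
    simp [Polynomial.coeff_X_pow, Polynomial.coeff_C, Polynomial.coeff_one]
    field_simp
    ring

lemma tendsto_W₂ : Tendsto W₂ atTop (𝓝 (Real.log 2)) := by
  have h : Tendsto (fun d : ℕ => 2 * ((d : ℝ) / (d + 1))) atTop (𝓝 (2 * 1)) :=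
    (tendsto_natCast_div_add_atTop (1 : ℝ)).const_mul 2
  rw [mul_one] at h
  refine ((Real.continuousAt_log (by norm_num)).tendsto.comp h).congr fun d => ?_
  simp only [Function.comp, W₂, mul_div_assoc]

end Bounds

end QuantumDesign

theorem mainTheorem2 :
    -- every 2-design POVM has informational power at most `W₂ d`
    (∀ (d : ℕ), 1 ≤ d → ∀ (Y : Type*) [MeasurableSpace Y] (ν : Measure Y) [SigmaFinite ν]
      (π : Y → QuantumDesign.Op d), QuantumDesign.IsDesignPOVM 2 ν π →
        QuantumDesign.informationalPower ν π ≤ ENNReal.ofReal (QuantumDesign.W₂ d)) ∧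
    -- SICs are examples
    (∀ (d : ℕ), 1 ≤ d → ∀ φ : Fin (d ^ 2) → EuclideanSpace ℂ (Fin d), QuantumDesign.IsSIC φ →
      QuantumDesign.IsDesignPOVM 2 Measure.count (QuantumDesign.sicPOVM φ) ∧
        QuantumDesign.informationalPower Measure.count (QuantumDesign.sicPOVM φ) ≤
          ENNReal.ofReal (QuantumDesign.W₂ d)) ∧
    -- complete sets of MUBs are examples
    (∀ (d : ℕ), 1 ≤ d →
      ∀ b : Fin (d + 1) → OrthonormalBasis (Fin d) ℂ (EuclideanSpace ℂ (Fin d)),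
      QuantumDesign.IsCompleteMUB b →
      QuantumDesign.IsDesignPOVM 2 Measure.count (QuantumDesign.mubPOVM b) ∧
        QuantumDesign.informationalPower Measure.count (QuantumDesign.mubPOVM b) ≤
          ENNReal.ofReal (QuantumDesign.W₂ d)) ∧
    -- among the interpolation bounds for `t = 2`, the node `2 / (d + 1)` gives the least, `W₂ d`
    (∀ (d : ℕ), 2 ≤ d →
      (∃ p, QuantumDesign.IsInterpolant 2 (fun _ => 2 / ((d : ℝ) + 1)) p ∧
        QuantumDesign.interpolationBound d 2 p = QuantumDesign.W₂ d) ∧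
      (∀ (x : Fin (2 / 2) → ℝ) (p : Polynomial ℝ), QuantumDesign.IsInterpolant 2 x p →
        QuantumDesign.W₂ d ≤ QuantumDesign.interpolationBound d 2 p)) ∧
    -- the limit is one bit
    Tendsto QuantumDesign.W₂ atTop (𝓝 (Real.log 2)) := by
  refine ⟨fun d hd Y _ ν _ π h => h.informationalPower_le hd, fun d hd φ h => ?_,
    fun d hd b h => ?_, fun d hd => ⟨QuantumDesign.exists_interpolant hd, fun x p h =>
      QuantumDesign.W₂_le_interpolationBound (by omega) h⟩, QuantumDesign.tendsto_W₂⟩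
  · have := QuantumDesign.isDesignPOVM_sicPOVM hd h
    exact ⟨this, this.informationalPower_le hd⟩
  · have := QuantumDesign.isDesignPOVM_mubPOVM hd h
    exact ⟨this, this.informationalPower_le hd⟩
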